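/- Let $E$ be a (real) Banach lattice, with norm dual $E'$ ordered by $f\le g$ if and only if $f(x)\le g(x)$ for all $x\ge 0$ in $E$; with this order $E'$ is a vector lattice. A sequence $(x_n')\subseteq E'$ is called $uaw^*$-null if, for every $u'\in E'$ with $u'\ge 0$, the sequence $|x_n'|\wedge u'$ converges to $0$ in the weak$^*$ topology of $E'$. The Banach lattice $E$ is said to have the unbounded Grothendieck property if every norm bounded $uaw^*$-null sequence in $E'$ is weakly null, that is, converges to $0$ in the topology $\sigma(E',E'')$. Theorem. A Banach lattice $E$ is reflexive if and only if it has the unbounded Grothendieck property. -/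

import Mathlib

open Filter Topology

noncomputable section

namespace BanachLattice

section Dual

variable {E : Type*} [NormedAddCommGroup E] [Lattice E] [HasSolidNorm E] [IsOrderedAddMonoid E]
  [NormedSpace ℝ E] [IsOrderedModule ℝ E]

/-- The dual order on `E'`: `f ≤ g` if and only if `f x ≤ g x` for every `x ≥ 0`. -/
instance dualPartialOrder : PartialOrder (StrongDual ℝ E) where
  le f g := ∀ x : E, 0 ≤ x → f x ≤ g x
  le_refl f x _ := le_rfl
  le_trans f g h hfg hgh x hx := (hfg x hx).trans (hgh x hx)
  le_antisymm f g hfg hgf := by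
    have key : ∀ x : E, 0 ≤ x → f x = g x := fun x hx => le_antisymm (hfg x hx) (hgf x hx)
    ext x
    rw [← posPart_sub_negPart x, map_sub, map_sub, key _ (posPart_nonneg x),
      key _ (negPart_nonneg x)]

theorem dual_le_def (f g : StrongDual ℝ E) : f ≤ g ↔ ∀ x : E, 0 ≤ x → f x ≤ g x := Iff.rfl

/-- `conePosPart f x = sup {f y : 0 ≤ y ≤ x}`, used for `x ≥ 0`. -/
def conePosPart (f : StrongDual ℝ E) (x : E) : ℝ := sSup (f '' Set.Icc 0 x)

theorem norm_le_of_mem_Icc {x y : E} (h : y ∈ Set.Icc 0 x) : ‖y‖ ≤ ‖x‖ := by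
  apply norm_le_norm_of_abs_le_abs
  rw [abs_of_nonneg h.1, abs_of_nonneg (h.1.trans h.2)]
  exact h.2

theorem apply_le_of_mem_Icc (f : StrongDual ℝ E) {x y : E} (h : y ∈ Set.Icc 0 x) :
    f y ≤ ‖f‖ * ‖x‖ :=
  (le_abs_self _).trans ((f.le_opNorm y).trans
    (mul_le_mul_of_nonneg_left (norm_le_of_mem_Icc h) (norm_nonneg f)))

theorem isLUB_conePosPart (f : StrongDual ℝ E) {x : E} (hx : 0 ≤ x) :
    IsLUB (f '' Set.Icc 0 x) (conePosPart f x) := by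
  apply isLUB_csSup
  · exact ⟨f 0, 0, ⟨le_rfl, hx⟩, rfl⟩
  · refine ⟨‖f‖ * ‖x‖, ?_⟩
    rintro _ ⟨y, hy, rfl⟩
    exact apply_le_of_mem_Icc f hy

theorem le_conePosPart (f : StrongDual ℝ E) {x y : E} (hy : 0 ≤ y) (hyx : y ≤ x) :
    f y ≤ conePosPart f x :=
  (isLUB_conePosPart f (hy.trans hyx)).1 ⟨y, ⟨hy, hyx⟩, rfl⟩

theorem conePosPart_le (f : StrongDual ℝ E) {x : E} (hx : 0 ≤ x) {c : ℝ}
    (h : ∀ y : E, 0 ≤ y → y ≤ x → f y ≤ c) : conePosPart f x ≤ c := by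
  apply (isLUB_conePosPart f hx).2
  rintro _ ⟨y, hy, rfl⟩
  exact h y hy.1 hy.2

theorem conePosPart_nonneg (f : StrongDual ℝ E) {x : E} (hx : 0 ≤ x) : 0 ≤ conePosPart f x := by
  simpa using le_conePosPart f (le_refl (0 : E)) hx

theorem conePosPart_le_norm (f : StrongDual ℝ E) {x : E} (hx : 0 ≤ x) :
    conePosPart f x ≤ ‖f‖ * ‖x‖ :=
  conePosPart_le f hx fun _ h0 h1 => apply_le_of_mem_Icc f ⟨h0, h1⟩

theorem conePosPart_add (f : StrongDual ℝ E) {x y : E} (hx : 0 ≤ x) (hy : 0 ≤ y) :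
    conePosPart f (x + y) = conePosPart f x + conePosPart f y := by
  apply le_antisymm
  · refine conePosPart_le f (add_nonneg hx hy) fun z hz hzxy => ?_
    have h1 : f (z ⊓ x) ≤ conePosPart f x := le_conePosPart f (le_inf hz hx) inf_le_right
    have h2 : f (z - z ⊓ x) ≤ conePosPart f y := by
      refine le_conePosPart f (sub_nonneg.2 inf_le_left) ?_
      rw [sub_le_comm]
      exact le_inf (sub_le_self z hy) (sub_le_iff_le_add.2 hzxy)
    rw [map_sub] at h2
    linarith
  · rw [← le_sub_iff_add_le]
    refine conePosPart_le f hx fun u hu hux => ?_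
    rw [le_sub_comm]
    refine conePosPart_le f hy fun v hv hvy => ?_
    rw [le_sub_iff_add_le, add_comm, ← map_add]
    exact le_conePosPart f (add_nonneg hu hv) (add_le_add hux hvy)

theorem conePosPart_smul_le (f : StrongDual ℝ E) {c : ℝ} (hc : 0 < c) {x : E} (hx : 0 ≤ x) :
    c * conePosPart f x ≤ conePosPart f (c • x) := by
  rw [← le_div_iff₀' hc]
  refine conePosPart_le f hx fun y hy hyx => ?_
  rw [le_div_iff₀' hc, ← smul_eq_mul, ← map_smul]
  exact le_conePosPart f (smul_nonneg hc.le hy) (smul_le_smul_of_nonneg_left hyx hc.le)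

theorem conePosPart_zero (f : StrongDual ℝ E) : conePosPart f 0 = 0 :=
  le_antisymm (by simpa using conePosPart_le_norm f (le_refl (0 : E)))
    (conePosPart_nonneg f le_rfl)

theorem conePosPart_smul (f : StrongDual ℝ E) {c : ℝ} (hc : 0 ≤ c) {x : E} (hx : 0 ≤ x) :
    conePosPart f (c • x) = c * conePosPart f x := by
  rcases hc.eq_or_lt with rfl | hc
  · simp [conePosPart_zero]
  · refine le_antisymm ?_ (conePosPart_smul_le f hc hx)
    have h := conePosPart_smul_le f (inv_pos.2 hc) (smul_nonneg hc.le hx)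
    rw [inv_smul_smul₀ hc.ne', inv_mul_le_iff₀ hc] at h
    exact h

/-- The extension of `conePosPart f` from the positive cone to `E`. -/
def posPartFun (f : StrongDual ℝ E) (x : E) : ℝ := conePosPart f x⁺ - conePosPart f x⁻

theorem posPartFun_sub (f : StrongDual ℝ E) {u v : E} (hu : 0 ≤ u) (hv : 0 ≤ v) :
    posPartFun f (u - v) = conePosPart f u - conePosPart f v := by
  have h : (u - v)⁺ + v = u + (u - v)⁻ := by
    have := posPart_sub_negPart (u - v)
    rw [sub_eq_sub_iff_add_eq_add] at this
    exact this
  have h' := congrArg (conePosPart f) h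
  rw [conePosPart_add f (posPart_nonneg _) hv, conePosPart_add f hu (negPart_nonneg _)] at h'
  unfold posPartFun
  linarith

theorem posPartFun_of_nonneg (f : StrongDual ℝ E) {x : E} (hx : 0 ≤ x) :
    posPartFun f x = conePosPart f x := by
  simpa [conePosPart_zero] using posPartFun_sub f hx (le_refl (0 : E))

theorem posPartFun_add (f : StrongDual ℝ E) (x y : E) :
    posPartFun f (x + y) = posPartFun f x + posPartFun f y := by
  have h : x + y = (x⁺ + y⁺) - (x⁻ + y⁻) := by
    conv_lhs => rw [← posPart_sub_negPart x, ← posPart_sub_negPart y]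
    abel
  rw [h, posPartFun_sub f (add_nonneg (posPart_nonneg _) (posPart_nonneg _))
    (add_nonneg (negPart_nonneg _) (negPart_nonneg _)),
    conePosPart_add f (posPart_nonneg _) (posPart_nonneg _),
    conePosPart_add f (negPart_nonneg _) (negPart_nonneg _)]
  unfold posPartFun
  ring

theorem posPartFun_smul (f : StrongDual ℝ E) (c : ℝ) (x : E) :
    posPartFun f (c • x) = c * posPartFun f x := by
  have hp := posPart_nonneg x
  have hn := negPart_nonneg x
  rcases le_total 0 c with hc | hc
  · have h : c • x = c • x⁺ - c • x⁻ := by rw [← smul_sub, posPart_sub_negPart]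
    rw [h, posPartFun_sub f (smul_nonneg hc hp) (smul_nonneg hc hn),
      conePosPart_smul f hc hp, conePosPart_smul f hc hn]
    unfold posPartFun
    ring
  · have hc' : 0 ≤ -c := neg_nonneg.2 hc
    have h : c • x = (-c) • x⁻ - (-c) • x⁺ := by
      rw [← smul_sub, neg_smul, ← smul_neg, neg_sub, posPart_sub_negPart]
    rw [h, posPartFun_sub f (smul_nonneg hc' hn) (smul_nonneg hc' hp),
      conePosPart_smul f hc' hp, conePosPart_smul f hc' hn]
    unfold posPartFun
    ring

theorem abs_posPartFun_le (f : StrongDual ℝ E) (x : E) : |posPartFun f x| ≤ ‖f‖ * ‖x‖ := by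
  have hp := posPart_nonneg x
  have hn := negPart_nonneg x
  have h1 : conePosPart f x⁺ + conePosPart f x⁻ ≤ ‖f‖ * ‖x‖ := by
    rw [← conePosPart_add f hp hn, posPart_add_negPart, ← norm_abs_eq_norm x]
    exact conePosPart_le_norm f (abs_nonneg x)
  have h2 := conePosPart_nonneg f hp
  have h3 := conePosPart_nonneg f hn
  unfold posPartFun
  rw [abs_le]
  constructor <;> linarith

/-- The positive part of a functional `f ∈ E'`, given by the Riesz–Kantorovich formula
`f⁺(x) = sup {f y : 0 ≤ y ≤ x}` for `x ≥ 0`. -/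
def dualPosPart (f : StrongDual ℝ E) : StrongDual ℝ E :=
  LinearMap.mkContinuous
    { toFun := posPartFun f
      map_add' := posPartFun_add f
      map_smul' := posPartFun_smul f } ‖f‖ (abs_posPartFun_le f)

theorem dualPosPart_apply (f : StrongDual ℝ E) {x : E} (hx : 0 ≤ x) :
    dualPosPart f x = sSup (f '' Set.Icc 0 x) :=
  posPartFun_of_nonneg f hx

theorem le_dualPosPart (f : StrongDual ℝ E) {x : E} (hx : 0 ≤ x) : f x ≤ dualPosPart f x := by
  rw [dualPosPart_apply f hx]
  exact le_conePosPart f hx le_rfl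

theorem dualPosPart_nonneg (f : StrongDual ℝ E) {x : E} (hx : 0 ≤ x) : 0 ≤ dualPosPart f x := by
  rw [dualPosPart_apply f hx]
  exact conePosPart_nonneg f hx

theorem dualPosPart_le (f g : StrongDual ℝ E) (hg : ∀ x : E, 0 ≤ x → 0 ≤ g x)
    (hfg : ∀ x : E, 0 ≤ x → f x ≤ g x) {x : E} (hx : 0 ≤ x) : dualPosPart f x ≤ g x := by
  rw [dualPosPart_apply f hx]
  refine conePosPart_le f hx fun y hy hyx => (hfg y hy).trans ?_
  have := hg (x - y) (sub_nonneg.2 hyx)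
  rw [map_sub] at this
  linarith

/-- The lattice structure of the dual `E'` of a normed lattice, for the dual order. -/
instance dualLattice : Lattice (StrongDual ℝ E) where
  __ := dualPartialOrder
  sup f g := g + dualPosPart (f - g)
  inf f g := f - dualPosPart (f - g)
  le_sup_left f g x hx := by
    have := le_dualPosPart (f - g) hx
    simp only [sub_apply, add_apply] at this ⊢
    linarith
  le_sup_right f g x hx := by
    have := dualPosPart_nonneg (f - g) hx
    simp only [add_apply]
    linarith
  sup_le f g h hf hg x hx := by
    have := dualPosPart_le (f - g) (h - g)
      (fun y hy => by have := hg y hy; simp only [sub_apply]; linarith)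
      (fun y hy => by have := hf y hy; simp only [sub_apply]; linarith) hx
    simp only [sub_apply, add_apply] at this ⊢
    linarith
  inf_le_left f g x hx := by
    have := dualPosPart_nonneg (f - g) hx
    simp only [sub_apply]
    linarith
  inf_le_right f g x hx := by
    have := le_dualPosPart (f - g) hx
    simp only [sub_apply] at this ⊢
    linarith
  le_inf h f g hf hg x hx := by
    have := dualPosPart_le (f - g) (f - h)
      (fun y hy => by have := hf y hy; simp only [sub_apply]; linarith)
      (fun y hy => by have := hg y hy; simp only [sub_apply]; linarith) hx
    simp only [sub_apply] at this ⊢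
    linarith

/-- Unbounded absolute weak* convergence of a sequence in `E'`: `f n → g` in this sense if
`|f n - g| ⊓ u → 0` in the weak* topology for every positive `u ∈ E'`. -/
def UawStarTendsto (f : ℕ → StrongDual ℝ E) (g : StrongDual ℝ E) : Prop :=
  ∀ u : StrongDual ℝ E, 0 ≤ u →
    Tendsto (fun n => StrongDual.toWeakDual (|f n - g| ⊓ u)) atTop (𝓝 0)

variable (E) in
/-- The unbounded Grothendieck property: every norm bounded sequence in `E'` that is
uaw*-null is weakly null. -/
def UnboundedGrothendieckProperty : Prop :=
  ∀ f : ℕ → StrongDual ℝ E, Bornology.IsBounded (Set.range f) → UawStarTendsto f 0 →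
    Tendsto (fun n => toWeakSpace ℝ (StrongDual ℝ E) (f n)) atTop (𝓝 0)

end Dual

/-- A normed space is reflexive if the canonical embedding into its bidual is surjective. -/
def IsReflexiveSpace (E : Type*) [NormedAddCommGroup E] [NormedSpace ℝ E] : Prop :=
  Function.Surjective (NormedSpace.inclusionInDoubleDual ℝ E)

end BanachLattice

end

/-!
Throughout, a norm is order continuous when increasing order bounded sequences converge
(`OrderContinuousNorm`).

If `E` is reflexive, such sequences converge weakly, and by a Dini argument in norm, so `E` has order
continuous norm. This forces the positive part of a ball of `E'` to be almost order bounded at each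
`x ≥ 0`: there is `F ≥ 0` with `(f - F)⁺ x < ε` for all `f` in it. Otherwise one finds functionals
`f n` and vectors `y n ∈ [0, x]` with `f n (y n)` bounded below but `f j (y n)` tiny for `j < n`,
and the limit superior of the `y n` gives a contradiction
(`OrderContinuousNorm.exists_posPart_sub_apply_lt`). As `|f| = |f| ⊓ F + (|f| - F)⁺`, a bounded
uaw*-null sequence then tends to zero at every element of `E = E''`.

Conversely, assume the unbounded Grothendieck property. A bounded almost disjoint sequence of `E'` is
uaw*-null, hence weakly null. This makes the unit ball of `E'` almost order bounded with respect to
every positive element of `E''`, so increasing sequences of `E` that are order bounded in `E''`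
converge in norm (`UnboundedGrothendieckProperty.exists_tendsto_of_monotone`). A decreasing sequence
of `E'` with pointwise infimum zero is uaw*-null as well, so `E'` has order continuous norm.

Given `Φ ≥ 0` in `E''`, let `y` be maximal among the positive elements of `E` below `Φ`, and suppose
`θ = Φ - y ≠ 0`. Since `E'` has order continuous norm, `θ` is not disjoint from `E`
(`apply_eq_zero_of_forall_inf_inclusion`), so some `θ ⊓ x` is nonzero. It dominates a nonzero
positive element of `E` (`exists_inclusion_le_of_le_inclusion`), contradicting the maximality of `y`.
The last two facts rest on a Hahn decomposition, `OrderContinuousNorm.exists_split`: functionals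
disjoint at `x` live on complementary parts of `x`. It serves in place of band projections.
-/

set_option linter.unusedSectionVars false

noncomputable section

namespace BanachLattice

/-! ### The dual as a normed lattice -/

section DualNormedLattice

variable {X : Type*} [NormedAddCommGroup X] [Lattice X] [HasSolidNorm X] [IsOrderedAddMonoid X]
  [NormedSpace ℝ X] [IsOrderedModule ℝ X]

instance dualIsOrderedAddMonoid : IsOrderedAddMonoid (StrongDual ℝ X) where
  add_le_add_left f g h k x hx := by simpa using h x hx

instance dualIsOrderedModule : IsOrderedModule ℝ (StrongDual ℝ X) where
  smul_le_smul_of_nonneg_left c hc f g h x hx := by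
    simpa using mul_le_mul_of_nonneg_left (h x hx) hc
  smul_le_smul_of_nonneg_right f hf c d h x hx := by
    have := hf x hx
    simpa using mul_le_mul_of_nonneg_right h (by simpa using this)

theorem dual_nonneg_iff {f : StrongDual ℝ X} : 0 ≤ f ↔ ∀ x : X, 0 ≤ x → 0 ≤ f x := Iff.rfl

theorem dual_apply_mono {f : StrongDual ℝ X} (hf : 0 ≤ f) {x y : X} (h : x ≤ y) : f x ≤ f y := by
  have := dual_nonneg_iff.1 hf (y - x) (sub_nonneg.2 h)
  rw [map_sub] at this
  linarith

theorem dual_posPart_eq (f : StrongDual ℝ X) : f⁺ = dualPosPart f := by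
  change 0 + dualPosPart (f - 0) = _
  rw [zero_add, sub_zero]

theorem posPart_apply_le (f : StrongDual ℝ X) {x : X} (hx : 0 ≤ x) {c : ℝ}
    (h : ∀ y : X, 0 ≤ y → y ≤ x → f y ≤ c) : f⁺ x ≤ c := by
  rw [dual_posPart_eq, dualPosPart_apply f hx]
  exact conePosPart_le f hx h

theorem exists_lt_of_lt_posPart_apply (f : StrongDual ℝ X) {x : X} (hx : 0 ≤ x) {c : ℝ}
    (h : c < f⁺ x) : ∃ y : X, 0 ≤ y ∧ y ≤ x ∧ c < f y := by
  by_contra! H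
  exact absurd (posPart_apply_le f hx H) (not_le.2 h)

theorem abs_apply_le_abs_apply_abs (f : StrongDual ℝ X) (x : X) : |f x| ≤ |f| |x| := by
  have h1 : ∀ y : X, 0 ≤ y → |f y| ≤ |f| y := fun y hy =>
    abs_le.2 ⟨by have := neg_le_abs f y hy; simp only [neg_apply] at this; linarith,
      le_abs_self f y hy⟩
  have h2 : f x = f x⁺ - f x⁻ := by rw [← map_sub, posPart_sub_negPart]
  rw [h2, ← posPart_add_negPart x, map_add]
  exact (abs_sub _ _).trans (add_le_add (h1 _ (posPart_nonneg x)) (h1 _ (negPart_nonneg x)))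

theorem abs_apply_le_norm (f : StrongDual ℝ X) {x : X} (hx : 0 ≤ x) : |f| x ≤ ‖f‖ * ‖x‖ := by
  have h : |f| = -f + (f - -f)⁺ := by
    rw [dual_posPart_eq]; rfl
  have h2 : (f - -f)⁺ x ≤ f x + ‖f‖ * ‖x‖ := by
    refine posPart_apply_le _ hx fun y hy hyx => ?_
    have h3 : f (y + y - x) ≤ ‖f‖ * ‖x‖ := by
      refine (le_abs_self _).trans ((f.le_opNorm _).trans
        (mul_le_mul_of_nonneg_left (norm_le_norm_of_abs_le_abs ?_) (norm_nonneg f)))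
      rw [abs_of_nonneg hx]
      refine abs_le'.2 ⟨?_, ?_⟩
      · rw [sub_le_iff_le_add]; exact add_le_add hyx hyx
      · rw [neg_sub]; exact sub_le_self x (add_nonneg hy hy)
    simp only [map_sub, map_add] at h3
    simp only [sub_apply, neg_apply]
    linarith
  rw [h]
  simp only [add_apply, neg_apply]
  linarith

instance dualHasSolidNorm : HasSolidNorm (StrongDual ℝ X) where
  solid f g h := by
    refine f.opNorm_le_bound (norm_nonneg g) fun x => ?_
    rw [Real.norm_eq_abs, ← norm_abs_eq_norm x]
    exact (abs_apply_le_abs_apply_abs f x).trans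
      ((h _ (abs_nonneg x)).trans (abs_apply_le_norm g (abs_nonneg x)))

theorem norm_le_norm_of_nonneg_of_le {x y : X} (hx : 0 ≤ x) (h : x ≤ y) : ‖x‖ ≤ ‖y‖ :=
  norm_le_of_mem_Icc ⟨hx, h⟩

theorem inf_apply_le_left (f g : StrongDual ℝ X) {x : X} (hx : 0 ≤ x) : (f ⊓ g) x ≤ f x :=
  (inf_le_left : f ⊓ g ≤ f) x hx

/-- The Riesz–Kantorovich formula for the infimum of two functionals, as an approximation
statement: `(f ⊓ g) x` is the infimum of `f a + g (x - a)` over `0 ≤ a ≤ x`. -/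
theorem exists_add_lt_of_inf_apply_lt (f g : StrongDual ℝ X) {x : X} (hx : 0 ≤ x) {c : ℝ}
    (h : (f ⊓ g) x < c) : ∃ a : X, 0 ≤ a ∧ a ≤ x ∧ f a + g (x - a) < c := by
  have h1 : (f ⊓ g) x = f x - (f - g)⁺ x := by rw [dual_posPart_eq]; rfl
  obtain ⟨y, hy, hyx, hlt⟩ := exists_lt_of_lt_posPart_apply (f - g) hx (c := f x - c) (by linarith)
  refine ⟨x - y, sub_nonneg.2 hyx, sub_le_self x hy, ?_⟩
  simp only [sub_apply, map_sub, sub_sub_cancel] at hlt ⊢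
  linarith

theorem exists_nonneg_functional {x : X} (hx : 0 ≤ x) :
    ∃ f : StrongDual ℝ X, 0 ≤ f ∧ ‖f‖ ≤ 1 ∧ ‖x‖ ≤ f x := by
  obtain ⟨g, hg, hgx⟩ := exists_dual_vector'' ℝ x
  refine ⟨|g|, abs_nonneg g, by rwa [norm_abs_eq_norm], ?_⟩
  have := le_abs_self g x hx
  rw [hgx] at this
  simpa using this

/-- The positive cone of a normed lattice is determined by the positive functionals. -/
theorem nonneg_of_forall_dual_nonneg {x : X}
    (h : ∀ f : StrongDual ℝ X, 0 ≤ f → 0 ≤ f x) : 0 ≤ x := by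
  by_contra hx
  obtain ⟨f, u, hfx, hf⟩ := geometric_hahn_banach_point_closed (t := {y : X | 0 ≤ y})
    (fun a ha b hb s t hs ht _ => add_nonneg (smul_nonneg hs ha) (smul_nonneg ht hb))
    isClosed_nonneg hx
  have hu : u < 0 := by simpa using hf 0 le_rfl
  refine absurd (h f (dual_nonneg_iff.2 fun y hy => ?_)) (by linarith)
  -- `f` is bounded below on the ray spanned by `y`, hence nonnegative there
  by_contra! hneg
  have := hf ((u / f y) • y) (smul_nonneg (div_nonneg_of_nonpos hu.le hneg.le) hy)
  rw [map_smul, smul_eq_mul, div_mul_cancel₀ _ hneg.ne] at this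
  exact lt_irrefl _ this

theorem eq_zero_of_forall_nonneg_apply {f : StrongDual ℝ X} (h : ∀ x : X, 0 ≤ x → f x = 0) :
    f = 0 :=
  le_antisymm (fun x hx => (h x hx).le) (fun x hx => (h x hx).ge)

theorem exists_apply_pos {f : StrongDual ℝ X} (hf : 0 ≤ f) (h : f ≠ 0) :
    ∃ x : X, 0 ≤ x ∧ 0 < f x := by
  by_contra! H
  exact h (eq_zero_of_forall_nonneg_apply fun x hx => le_antisymm (H x hx) (hf x hx))

end DualNormedLattice

/-! ### Monotone sequences -/

section Monotone

variable {X : Type*} [NormedAddCommGroup X] [Lattice X] [HasSolidNorm X] [IsOrderedAddMonoid X]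
  [NormedSpace ℝ X] [IsOrderedModule ℝ X]

/-- A decreasing positive sequence that is weakly null is norm null: the vectors above some term
form a convex set whose weak closure, that is its norm closure, contains `0`. -/
theorem tendsto_zero_of_antitone_of_weakly_null {y : ℕ → X} (hy : Antitone y) (h0 : ∀ n, 0 ≤ y n)
    (hw : ∀ f : StrongDual ℝ X, Tendsto (fun n => f (y n)) atTop (𝓝 0)) :
    Tendsto y atTop (𝓝 0) := by
  set C : Set X := {v | ∃ n, y n ≤ v} with hC
  have hconv : Convex ℝ C := by
    rintro a ⟨m, hm⟩ b ⟨n, hn⟩ s t hs ht hst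
    refine ⟨max m n, ?_⟩
    calc y (max m n) = s • y (max m n) + t • y (max m n) := by rw [← add_smul, hst, one_smul]
      _ ≤ s • a + t • b := add_le_add
        (smul_le_smul_of_nonneg_left ((hy (le_max_left m n)).trans hm) hs)
        (smul_le_smul_of_nonneg_left ((hy (le_max_right m n)).trans hn) ht)
  have hmem : (0 : X) ∈ closure C := by
    by_contra hn
    obtain ⟨f, u, hf0, hf⟩ := geometric_hahn_banach_point_closed hconv.closure isClosed_closure hn
    rw [map_zero] at hf0
    exact absurd (ge_of_tendsto' (hw f) fun n => (hf _ (subset_closure ⟨n, le_rfl⟩)).le)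
      (not_le.2 hf0)
  rw [Metric.tendsto_atTop]
  intro ε hε
  obtain ⟨v, ⟨N, hN⟩, hv⟩ := Metric.mem_closure_iff.1 hmem ε hε
  refine ⟨N, fun n hn => ?_⟩
  rw [dist_zero_left] at hv
  rw [dist_zero_right]
  exact (norm_le_norm_of_nonneg_of_le (h0 n) ((hy hn).trans hN)).trans_lt hv

theorem exists_tendsto_of_monotone_of_le {u : ℕ → ℝ} (hu : Monotone u) {c : ℝ} (hc : ∀ n, u n ≤ c) :
    ∃ l, Tendsto u atTop (𝓝 l) :=
  ⟨_, tendsto_atTop_ciSup hu ⟨c, by rintro _ ⟨n, rfl⟩; exact hc n⟩⟩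

/-- An increasing pointwise bounded sequence of functionals has a pointwise limit in the dual. -/
theorem exists_pointwise_limit_of_monotone [CompleteSpace X] {f : ℕ → StrongDual ℝ X}
    (hf : Monotone f) {c : X → ℝ} (hc : ∀ x : X, 0 ≤ x → ∀ n, f n x ≤ c x) :
    ∃ g : StrongDual ℝ X, (∀ x : X, Tendsto (fun n => f n x) atTop (𝓝 (g x))) ∧ ∀ n, f n ≤ g := by
  have hpos : ∀ x : X, 0 ≤ x → ∃ l, Tendsto (fun n => f n x) atTop (𝓝 l) :=
    fun x hx => exists_tendsto_of_monotone_of_le (fun m n h => hf h x hx) (hc x hx)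
  have hall : ∀ x : X, ∃ l, Tendsto (fun n => f n x) atTop (𝓝 l) := by
    intro x
    obtain ⟨l, hl⟩ := hpos x⁺ (posPart_nonneg x)
    obtain ⟨m, hm⟩ := hpos x⁻ (negPart_nonneg x)
    refine ⟨l - m, (hl.sub hm).congr fun n => ?_⟩
    rw [← map_sub, posPart_sub_negPart]
  choose L hL using hall
  refine ⟨continuousLinearMapOfTendsto f (tendsto_pi_nhds.2 hL), hL, fun n x hx => ?_⟩
  exact ge_of_tendsto (hL x) (eventually_atTop.2 ⟨n, fun m hm => hf hm x hx⟩)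

theorem inclusionInDoubleDual_mono {x y : X} (h : x ≤ y) :
    NormedSpace.inclusionInDoubleDual ℝ X x ≤ NormedSpace.inclusionInDoubleDual ℝ X y :=
  fun _ hf => dual_apply_mono hf h

/-- Order continuity of the norm, in a sequential form: increasing order bounded positive sequences
converge in norm. For a Banach lattice this is equivalent to the usual definition by nets, and it
entails Dedekind completeness. -/
def OrderContinuousNorm (X : Type*) [NormedAddCommGroup X] [Lattice X] : Prop :=
  ∀ (y : ℕ → X) (x : X), Monotone y → (∀ n, 0 ≤ y n) → (∀ n, y n ≤ x) →
    ∃ a, Tendsto y atTop (𝓝 a)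

theorem OrderContinuousNorm.exists_tendsto_of_antitone (hX : OrderContinuousNorm X) {y : ℕ → X}
    (hy : Antitone y) (h0 : ∀ n, 0 ≤ y n) : ∃ a, Tendsto y atTop (𝓝 a) := by
  obtain ⟨a, ha⟩ := hX (fun n => y 0 - y n) (y 0) (fun m n h => sub_le_sub_left (hy h) _)
    (fun n => sub_nonneg.2 (hy (Nat.zero_le n))) (fun n => sub_le_self _ (h0 n))
  exact ⟨y 0 - a, by simpa using ha.const_sub (y 0)⟩

/-- A sequence `y` in an order interval has tail suprema `z m = sup {y n : m ≤ n}`, and these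
converge to its limit superior `a`. A positive functional is bounded on `z m` by the sum of its
values on the tail. -/
theorem OrderContinuousNorm.exists_tail_sup (hX : OrderContinuousNorm X) {y : ℕ → X} {x : X}
    (h0 : ∀ n, 0 ≤ y n) (hx : ∀ n, y n ≤ x) :
    ∃ (z : ℕ → X) (a : X), (∀ m n, m ≤ n → y n ≤ z m) ∧ (∀ n, z n ≤ x) ∧ (∀ n, a ≤ z n) ∧ 0 ≤ a ∧
      Tendsto z atTop (𝓝 a) ∧ ∀ f : StrongDual ℝ X, 0 ≤ f → ∀ m c,
        (∀ n, ∑ k ∈ Finset.range n, f (y (m + k)) ≤ c) → f (z m) ≤ c := by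
  have hlim : ∀ m, ∃ z, Tendsto (fun n => partialSups (fun k => y (m + k)) n) atTop (𝓝 z) :=
    fun m => hX _ x (partialSups_monotone _)
      (fun n => (h0 m).trans (le_partialSups_of_le (fun k => y (m + k)) n.zero_le))
      (fun n => partialSups_le _ _ _ fun k _ => hx _)
  choose z hz using hlim
  have hle : ∀ m n, m ≤ n → y n ≤ z m := by
    intro m n hmn
    obtain ⟨k, rfl⟩ := Nat.exists_eq_add_of_le hmn
    exact ge_of_tendsto (hz m) (eventually_atTop.2 ⟨k, fun j hj =>
      le_partialSups_of_le (fun k => y (m + k)) hj⟩)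
  have hup : ∀ m u, (∀ n, m ≤ n → y n ≤ u) → z m ≤ u := fun m u hu =>
    le_of_tendsto' (hz m) fun n => partialSups_le _ _ _ fun k _ => hu _ (Nat.le_add_right m k)
  have hanti : Antitone z := fun m n hmn => hup n _ fun k hk => hle m k (hmn.trans hk)
  have hz0 : ∀ n, 0 ≤ z n := fun n => (h0 n).trans (hle n n le_rfl)
  obtain ⟨a, ha⟩ := hX.exists_tendsto_of_antitone hanti hz0
  refine ⟨z, a, hle, fun n => hup n x fun k _ => hx k, fun n => hanti.le_of_tendsto ha n,
    ge_of_tendsto' ha hz0, ha, fun f hf m c hc => ?_⟩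
  refine le_of_tendsto' ((f.continuous.tendsto _).comp (hz m)) fun n => ?_
  refine le_trans ?_ (hc (n + 1))
  rw [← map_sum]
  refine dual_apply_mono hf (partialSups_le _ _ _ fun k hk => ?_)
  exact Finset.single_le_sum (f := fun k => y (m + k)) (fun i _ => h0 _)
    (Finset.mem_range.2 (Nat.lt_succ_of_le hk))

/-- A closed set in which increasing sequences converge has a maximal element. -/
theorem exists_maximal_of_monotone_convergence {Y : Set X} (hYc : IsClosed Y) (hYn : Y.Nonempty)
    (hY : ∀ y : ℕ → X, Monotone y → (∀ n, y n ∈ Y) → ∃ a, Tendsto y atTop (𝓝 a)) :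
    ∃ a ∈ Y, ∀ b ∈ Y, a ≤ b → b = a := by
  -- above every element there is one above which `Y` has radius at most `ε`; otherwise there is an
  -- increasing sequence with steps longer than `ε`
  have hstep : ∀ ε : ℝ, 0 < ε → ∀ y : Y, ∃ y' : Y, (y : X) ≤ y' ∧
      ∀ b ∈ Y, (y' : X) ≤ b → ‖b - y'‖ ≤ ε := by
    intro ε hε y
    by_contra! H
    have H' : ∀ w : {w : Y // (y : X) ≤ w}, ∃ b : {w : Y // (y : X) ≤ w},
        (w : X) ≤ b ∧ ε < ‖(b : X) - w‖ := by
      rintro ⟨w, hw⟩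
      obtain ⟨b, hb, hwb, hlt⟩ := H w hw
      exact ⟨⟨⟨b, hb⟩, hw.trans hwb⟩, hwb, hlt⟩
    choose g hg hgε using H'
    let s : ℕ → {w : Y // (y : X) ≤ w} := fun n => g^[n] ⟨y, le_rfl⟩
    have hs : ∀ n, s (n + 1) = g (s n) := fun n => Function.iterate_succ_apply' g n _
    obtain ⟨a, ha⟩ := hY (fun n => (s n : X))
      (monotone_nat_of_le_succ fun n => by rw [hs]; exact hg _) (fun n => (s n).1.2)
    have h1 := (((tendsto_add_atTop_iff_nat 1).2 ha).sub ha).norm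
    rw [sub_self, norm_zero] at h1
    refine absurd (ge_of_tendsto' h1 fun n => ?_) (not_le.2 hε)
    rw [hs]
    exact (hgε (s n)).le
  choose g hg hgε using hstep
  have hpos : ∀ n : ℕ, (0 : ℝ) < 1 / (n + 1) := fun n => Nat.one_div_pos_of_nat
  obtain ⟨y₀, hy₀⟩ := hYn
  let s : ℕ → Y := fun n => Nat.rec ⟨y₀, hy₀⟩ (fun n w => g _ (hpos n) w) n
  have hs : ∀ n, s (n + 1) = g _ (hpos n) (s n) := fun n => rfl
  have hmono : Monotone fun n => (s n).1 :=
    monotone_nat_of_le_succ fun n => hg _ (hpos n) (s n)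
  obtain ⟨a, ha⟩ := hY _ hmono fun n => (s n).2
  refine ⟨a, hYc.mem_of_tendsto ha (Eventually.of_forall fun n => (s n).2), fun b hb hab => ?_⟩
  have h1 : Tendsto (fun n => ‖b - (s (n + 1)).1‖) atTop (𝓝 ‖b - a‖) :=
    (((tendsto_add_atTop_iff_nat 1).2 ha).const_sub b).norm
  have h2 : ‖b - a‖ ≤ 0 := le_of_tendsto_of_tendsto' h1 tendsto_one_div_add_atTop_nhds_zero_nat
    fun n => hgε _ (hpos n) (s n) b hb ((hmono.ge_of_tendsto ha (n + 1)).trans hab)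
  exact sub_eq_zero.1 (norm_le_zero_iff.1 h2)

/-- Two functionals that are disjoint at `x` live on complementary parts of `x`. The part on which
`g` lives is the limit superior of a sequence that splits `x` up to summable errors. -/
theorem OrderContinuousNorm.exists_split (hX : OrderContinuousNorm X) {f g : StrongDual ℝ X}
    (hf : 0 ≤ f) (hg : 0 ≤ g) {x : X} (hx : 0 ≤ x) (h : (f ⊓ g) x ≤ 0) :
    ∃ a : X, 0 ≤ a ∧ a ≤ x ∧ f a = 0 ∧ g (x - a) = 0 := by
  have hex : ∀ n : ℕ, ∃ a : X, 0 ≤ a ∧ a ≤ x ∧ f a + g (x - a) < (1 / 2 : ℝ) ^ n := fun n =>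
    exists_add_lt_of_inf_apply_lt f g hx (h.trans_lt (by positivity))
  choose y hy0 hyx hlt using hex
  obtain ⟨z, a, hyz, hzx, haz, ha0, hza, hsum⟩ := hX.exists_tail_sup hy0 hyx
  have hax : a ≤ x := (haz 0).trans (hzx 0)
  have hpow : Tendsto (fun n : ℕ => (1 / 2 : ℝ) ^ n) atTop (𝓝 0) :=
    tendsto_pow_atTop_nhds_zero_of_lt_one (by norm_num) (by norm_num)
  have hfy : ∀ n, f (y n) ≤ (1 / 2 : ℝ) ^ n := fun n => by
    have := hg (x - y n) (sub_nonneg.2 (hyx n))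
    have h' := hlt n
    simp only [zero_apply] at this
    linarith
  have hgy : ∀ n, g (x - y n) ≤ (1 / 2 : ℝ) ^ n := fun n => by
    have := hf (y n) (hy0 n)
    have h' := hlt n
    simp only [zero_apply] at this
    linarith
  refine ⟨a, ha0, hax, le_antisymm ?_ (hf a ha0), le_antisymm ?_ (hg _ (sub_nonneg.2 hax))⟩
  · refine ge_of_tendsto' (b := f a) (zero_mul (2 : ℝ) ▸ hpow.mul_const 2) fun m => ?_
    refine (dual_apply_mono hf (haz m)).trans (hsum f hf m _ fun n => ?_)
    calc ∑ k ∈ Finset.range n, f (y (m + k))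
        ≤ ∑ k ∈ Finset.range n, (1 / 2 : ℝ) ^ m * (1 / 2 : ℝ) ^ k :=
          Finset.sum_le_sum fun k _ => by rw [← pow_add]; exact hfy _
      _ ≤ (1 / 2 : ℝ) ^ m * 2 := by
          rw [← Finset.mul_sum]
          exact mul_le_mul_of_nonneg_left (sum_geometric_two_le n) (by positivity)
  · refine le_of_tendsto' ((g.continuous.tendsto _).comp (hza.const_sub x)) fun m => ?_
    refine ge_of_tendsto hpow (eventually_atTop.2 ⟨m, fun n hn => ?_⟩)
    exact (dual_apply_mono hg (sub_le_sub_left (hyz m n hn) x)).trans (hgy n)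

end Monotone

/-! ### Almost disjoint sequences -/

section AlmostDisjoint

variable {X : Type*} [NormedAddCommGroup X] [Lattice X] [HasSolidNorm X] [IsOrderedAddMonoid X]
  [NormedSpace ℝ X] [IsOrderedModule ℝ X]

/-- Recursive choice of a sequence in the positive cone in which each term is related to a large
multiple of the sum of its predecessors. -/
theorem exists_seq_rel_sum {R : X → X → Prop} (H : ∀ F : X, 0 ≤ F → ∃ f : X, 0 ≤ f ∧ R F f) :
    ∃ f : ℕ → X, (∀ n, 0 ≤ f n) ∧
      ∀ n, R ((2 : ℝ) ^ n • ∑ j ∈ Finset.range n, f j) (f n) := by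
  have H' : ∀ F : {F : X // 0 ≤ F}, ∃ f : {f : X // 0 ≤ f}, R F f := fun F =>
    let ⟨f, hf, h⟩ := H F F.2
    ⟨⟨f, hf⟩, h⟩
  choose g hg using H'
  let c : ℕ → {F : X // 0 ≤ F} → {F : X // 0 ≤ F} := fun n S =>
    ⟨(2 : ℝ) ^ n • (S : X), smul_nonneg (by positivity) S.2⟩
  let S : ℕ → {F : X // 0 ≤ F} := fun n =>
    Nat.rec ⟨0, le_rfl⟩ (fun n S => ⟨(S : X) + g (c n S), add_nonneg S.2 (g (c n S)).2⟩) n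
  have hS : ∀ n, (S n).1 = ∑ j ∈ Finset.range n, (g (c j (S j))).1 := by
    intro n
    induction n with
    | zero => rfl
    | succ n ih => rw [Finset.sum_range_succ, ← ih]
  refine ⟨fun n => g (c n (S n)), fun n => (g (c n (S n))).2, fun n => ?_⟩
  rw [← hS n]
  exact hg (c n (S n))

theorem posPart_sub_smul_inf_le {a b : X} (ha : 0 ≤ a) {c : ℝ} (hc : 0 ≤ c) :
    (a - c • b)⁺ ⊓ b ≤ (1 + c)⁻¹ • a := by
  let : DistribLattice X := AddCommGroup.toDistribLattice X
  have hc' : 0 < 1 + c := by linarith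
  have h : (1 + c) • ((a - c • b) ⊓ b) ≤ a := by
    rw [add_smul, one_smul]
    calc (a - c • b) ⊓ b + c • ((a - c • b) ⊓ b) ≤ (a - c • b) + c • b :=
          add_le_add inf_le_left (smul_le_smul_of_nonneg_left inf_le_right hc)
      _ = a := sub_add_cancel _ _
  rw [posPart_def, inf_sup_right]
  refine sup_le ?_ (inf_le_left.trans (smul_nonneg (inv_nonneg.2 hc'.le) ha))
  have := smul_le_smul_of_nonneg_left h (inv_nonneg.2 hc'.le)
  rwa [inv_smul_smul₀ hc'.ne'] at this

theorem posPart_sub_le_self {a b : X} (ha : 0 ≤ a) (hb : 0 ≤ b) : (a - b)⁺ ≤ a :=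
  sup_le (sub_le_self a hb) ha

/-- For positive sequences, unbounded absolute weak* convergence to zero can be tested pointwise on
the positive cone. -/
theorem uawStarTendsto_zero_of_nonneg {h : ℕ → StrongDual ℝ X} (h0 : ∀ n, 0 ≤ h n)
    (H : ∀ u : StrongDual ℝ X, 0 ≤ u → ∀ x : X, 0 ≤ x →
      Tendsto (fun n => (h n ⊓ u) x) atTop (𝓝 0)) : UawStarTendsto h 0 := by
  intro u hu
  rw [tendsto_iff_forall_eval_tendsto_topDualPairing]
  intro x
  simp only [sub_zero, abs_of_nonneg (h0 _)]
  change Tendsto (fun n => (h n ⊓ u) x) atTop (𝓝 0)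
  have := (H u hu x⁺ (posPart_nonneg x)).sub (H u hu x⁻ (negPart_nonneg x))
  rw [sub_zero] at this
  refine this.congr fun n => ?_
  rw [← map_sub, posPart_sub_negPart]

/-- Removing from each term a large multiple of its predecessors leaves a sequence that is almost
disjoint. Below a fixed `u` its terms have sum at most `u` up to a convergent error, since
`a + b = a ⊔ b + a ⊓ b`. -/
theorem uawStarTendsto_posPart_sub_sum {f : ℕ → StrongDual ℝ X} (h0 : ∀ n, 0 ≤ f n)
    (hb : ∀ n, ‖f n‖ ≤ 1) :
    UawStarTendsto (fun n => (f n - (2 : ℝ) ^ n • ∑ j ∈ Finset.range n, f j)⁺) 0 := by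
  refine uawStarTendsto_zero_of_nonneg (fun n => posPart_nonneg _) fun u hu x hx => ?_
  set S : ℕ → StrongDual ℝ X := fun n => ∑ j ∈ Finset.range n, f j with hS
  have hS0 : ∀ n, 0 ≤ (2 : ℝ) ^ n • S n := fun n =>
    smul_nonneg (by positivity) (Finset.sum_nonneg fun j _ => h0 j)
  set a : ℕ → StrongDual ℝ X := fun n => (f n - (2 : ℝ) ^ n • S n)⁺ ⊓ u with ha
  have ha0 : ∀ n, 0 ≤ a n := fun n => le_inf (posPart_nonneg _) hu
  have haf : ∀ n, a n ≤ f n := fun n => inf_le_left.trans (posPart_sub_le_self (h0 n) (hS0 n))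
  have hmeet : ∀ n, S n ⊓ a n ≤ (1 / 2 : ℝ) ^ n • f n := fun n =>
    calc S n ⊓ a n ≤ (f n - (2 : ℝ) ^ n • S n)⁺ ⊓ S n :=
          le_inf (inf_le_right.trans inf_le_left) inf_le_left
      _ ≤ (1 + (2 : ℝ) ^ n)⁻¹ • f n := posPart_sub_smul_inf_le (h0 n) (by positivity)
      _ ≤ (1 / 2 : ℝ) ^ n • f n := by
          refine smul_le_smul_of_nonneg_right ?_ (h0 n)
          rw [one_div, inv_pow]
          exact inv_anti₀ (by positivity) (by linarith)
  have hsum : ∀ n, ∑ k ∈ Finset.range n, a k ≤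
      u + ∑ k ∈ Finset.range n, (1 / 2 : ℝ) ^ k • f k := by
    intro n
    induction n with
    | zero => simpa using hu
    | succ n ih =>
      have hE : 0 ≤ ∑ k ∈ Finset.range n, (1 / 2 : ℝ) ^ k • f k :=
        Finset.sum_nonneg fun k _ => smul_nonneg (by positivity) (h0 k)
      rw [Finset.sum_range_succ, Finset.sum_range_succ, ← add_assoc, ← inf_add_sup, add_comm]
      refine add_le_add (sup_le ih (inf_le_right.trans (le_add_of_nonneg_right hE))) ?_
      exact (inf_le_inf_right _ (Finset.sum_le_sum fun k _ => haf k)).trans (hmeet n)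
  have hsx : Summable fun n => a n x := by
    refine summable_of_sum_range_le (c := u x + 2 * ‖x‖) (fun n => ha0 n x hx) fun n => ?_
    have h1 := hsum n x hx
    rw [add_apply, sum_apply, sum_apply] at h1
    refine h1.trans (add_le_add le_rfl ?_)
    calc ∑ k ∈ Finset.range n, ((1 / 2 : ℝ) ^ k • f k) x
        ≤ ∑ k ∈ Finset.range n, (1 / 2 : ℝ) ^ k * ‖x‖ := by
          refine Finset.sum_le_sum fun k _ => ?_
          rw [smul_apply, smul_eq_mul]
          refine mul_le_mul_of_nonneg_left ?_ (by positivity)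
          exact (le_abs_self _).trans (((f k).le_opNorm x).trans
            (mul_le_of_le_one_left (norm_nonneg x) (hb k)))
      _ ≤ 2 * ‖x‖ := by
          rw [← Finset.sum_mul]
          exact mul_le_mul_of_nonneg_right (sum_geometric_two_le n) (norm_nonneg x)
  exact hsx.tendsto_atTop_zero

end AlmostDisjoint

/-! ### Reflexivity implies the unbounded Grothendieck property -/

section Forward

theorem tendsto_toWeakSpace_zero_iff {X : Type*} [NormedAddCommGroup X] [NormedSpace ℝ X]
    {f : ℕ → X} : Tendsto (fun n => toWeakSpace ℝ X (f n)) atTop (𝓝 0) ↔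
      ∀ Φ : StrongDual ℝ X, Tendsto (fun n => Φ (f n)) atTop (𝓝 0) := by
  have hB : Function.Injective (topDualPairing ℝ X).flip := by
    intro x y hxy
    by_contra hne
    obtain ⟨Φ, hΦ⟩ := geometric_hahn_banach_point_point hne
    exact hΦ.ne (LinearMap.congr_fun hxy Φ)
  refine (WeakBilin.tendsto_iff_forall_eval_tendsto (topDualPairing ℝ X).flip hB).trans ?_
  refine forall_congr' fun Φ => ?_
  change Tendsto (fun n => Φ (f n)) atTop (𝓝 (Φ 0)) ↔ _
  rw [map_zero]

variable {E : Type*} [NormedAddCommGroup E] [Lattice E] [HasSolidNorm E] [IsOrderedAddMonoid E]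
  [NormedSpace ℝ E] [IsOrderedModule ℝ E]

theorem IsReflexiveSpace.orderContinuousNorm (h : IsReflexiveSpace E) : OrderContinuousNorm E := by
  intro y x hy h0 hx
  obtain ⟨Φ, hΦ, hle⟩ := exists_pointwise_limit_of_monotone
    (f := fun n => NormedSpace.inclusionInDoubleDual ℝ E (y n)) (c := fun f => f x)
    (fun m n hmn => inclusionInDoubleDual_mono (hy hmn)) (fun f hf n => dual_apply_mono hf (hx n))
  obtain ⟨a, rfl⟩ := h Φ
  have hya : ∀ n, y n ≤ a := fun n => sub_nonneg.1 <| nonneg_of_forall_dual_nonneg fun f hf => by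
    rw [map_sub, sub_nonneg]
    exact hle n f hf
  have := tendsto_zero_of_antitone_of_weakly_null (y := fun n => a - y n)
    (fun m n hmn => sub_le_sub_left (hy hmn) a) (fun n => sub_nonneg.2 (hya n)) fun f => by
      simpa using (hΦ f).const_sub (f a)
  exact ⟨a, by simpa using this.const_sub a⟩

/-- In a lattice with order continuous norm, a bounded set of positive functionals is, uniformly at
`x`, almost dominated by a single functional. -/
theorem OrderContinuousNorm.exists_posPart_sub_apply_lt (hE : OrderContinuousNorm E) {x : E}
    (hx : 0 ≤ x) {ε : ℝ} (hε : 0 < ε) (M : ℝ) :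
    ∃ F : StrongDual ℝ E, 0 ≤ F ∧
      ∀ f : StrongDual ℝ E, 0 ≤ f → ‖f‖ ≤ M → (f - F)⁺ x < ε := by
  by_contra! H
  obtain ⟨f, hf0, hf⟩ := exists_seq_rel_sum (R := fun F f : StrongDual ℝ E => ‖f‖ ≤ M ∧ ε ≤ (f - F)⁺ x) H
  set S : ℕ → StrongDual ℝ E := fun n => ∑ j ∈ Finset.range n, f j with hS
  have hex : ∀ n, ∃ y : E, 0 ≤ y ∧ y ≤ x ∧ ε / 2 < (f n - (2 : ℝ) ^ n • S n) y := fun n =>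
    exists_lt_of_lt_posPart_apply _ hx ((half_lt_self hε).trans_le (hf n).2)
  choose y hy0 hyx hlt using hex
  have hM : 0 ≤ M := (norm_nonneg _).trans (hf 0).1
  have hfM : ∀ n, ∀ w : E, f n w ≤ M * ‖w‖ := fun n w => (le_abs_self _).trans
    (((f n).le_opNorm w).trans (mul_le_mul_of_nonneg_right (hf n).1 (norm_nonneg w)))
  have hSy : ∀ n, 0 ≤ (2 : ℝ) ^ n * S n (y n) := fun n =>
    mul_nonneg (by positivity) ((Finset.sum_nonneg fun j _ => hf0 j : 0 ≤ S n) _ (hy0 n))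
  simp only [sub_apply, smul_apply, smul_eq_mul] at hlt
  -- each vector is almost annihilated by the earlier functionals
  have hsmall : ∀ j n, j < n → f j (y n) ≤ (1 / 2 : ℝ) ^ n * (M * ‖x‖) := by
    intro j n hjn
    have h1 : f j (y n) ≤ S n (y n) :=
      (Finset.single_le_sum (f := f) (fun i _ => hf0 i) (Finset.mem_range.2 hjn) :
        f j ≤ S n) _ (hy0 n)
    have h2 : (2 : ℝ) ^ n * S n (y n) ≤ M * ‖x‖ := by
      have := (hfM n (y n)).trans (mul_le_mul_of_nonneg_left
        (norm_le_norm_of_nonneg_of_le (hy0 n) (hyx n)) hM)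
      have := hlt n
      linarith
    rw [one_div, inv_pow]
    exact h1.trans ((le_inv_mul_iff₀ (by positivity)).2 h2)
  obtain ⟨z, a, hyz, -, haz, ha0, hza, hsum⟩ := hE.exists_tail_sup hy0 hyx
  have hpow : Tendsto (fun n : ℕ => (1 / 2 : ℝ) ^ n) atTop (𝓝 0) :=
    tendsto_pow_atTop_nhds_zero_of_lt_one (by norm_num) (by norm_num)
  have hfa : ∀ j, f j a ≤ 0 := by
    intro j
    refine ge_of_tendsto (zero_mul (2 * (M * ‖x‖)) ▸ hpow.mul_const (2 * (M * ‖x‖)))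
      (eventually_atTop.2 ⟨j + 1, fun m hm => ?_⟩)
    refine (dual_apply_mono (hf0 j) (haz m)).trans (hsum _ (hf0 j) m _ fun n => ?_)
    calc ∑ k ∈ Finset.range n, f j (y (m + k))
        ≤ ∑ k ∈ Finset.range n, (1 / 2 : ℝ) ^ m * (M * ‖x‖) * (1 / 2 : ℝ) ^ k :=
          Finset.sum_le_sum fun k _ => (hsmall j (m + k) (by omega)).trans_eq (by ring)
      _ ≤ (1 / 2 : ℝ) ^ m * (M * ‖x‖) * 2 := by
          rw [← Finset.mul_sum]
          exact mul_le_mul_of_nonneg_left (sum_geometric_two_le n) (by positivity)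
      _ = (1 / 2 : ℝ) ^ m * (2 * (M * ‖x‖)) := by ring
  have hlim : Tendsto (fun n => M * ‖z n - a‖) atTop (𝓝 0) := by
    simpa using ((hza.sub_const a).norm.const_mul M)
  refine absurd (ge_of_tendsto' hlim fun n => ?_) (not_le.2 (half_pos hε))
  have h1 := dual_apply_mono (hf0 n) (hyz n n le_rfl)
  have h2 := hfM n (z n - a)
  rw [map_sub] at h2
  linarith [hlt n, hSy n, hfa n]

theorem IsReflexiveSpace.unboundedGrothendieckProperty (h : IsReflexiveSpace E) :
    UnboundedGrothendieckProperty E := by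
  intro f hb hu
  obtain ⟨M, hM⟩ := hb.exists_norm_le
  have hfM : ∀ n, ‖f n‖ ≤ M := fun n => hM _ ⟨n, rfl⟩
  have habs : ∀ x : E, 0 ≤ x → Tendsto (fun n => |f n| x) atTop (𝓝 0) := by
    intro x hx
    rw [Metric.tendsto_atTop]
    intro ε hε
    obtain ⟨F, hF0, hF⟩ := h.orderContinuousNorm.exists_posPart_sub_apply_lt hx (half_pos hε) M
    have hmeet : Tendsto (fun n => (|f n| ⊓ F) x) atTop (𝓝 0) := by
      have : Tendsto (fun n => (|f n - 0| ⊓ F) x) atTop (𝓝 0) :=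
        tendsto_iff_forall_eval_tendsto_topDualPairing.1 (hu F hF0) x
      simpa only [sub_zero] using this
    obtain ⟨N, hN⟩ := Metric.tendsto_atTop.1 hmeet (ε / 2) (half_pos hε)
    refine ⟨N, fun n hn => ?_⟩
    have h1 := hF |f n| (abs_nonneg _) (by rw [norm_abs_eq_norm]; exact hfM n)
    have h2 : (|f n| ⊓ F) x < ε / 2 := by
      have := hN n hn
      rw [Real.dist_0_eq_abs] at this
      exact (le_abs_self _).trans_lt this
    have h3 : |f n| x = (|f n| ⊓ F) x + (|f n| - F)⁺ x := by
      rw [← add_apply, inf_eq_sub_posPart_sub, sub_add_cancel]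
    rw [Real.dist_0_eq_abs, abs_of_nonneg ((abs_nonneg (f n) : 0 ≤ |f n|) x hx)]
    linarith
  refine tendsto_toWeakSpace_zero_iff.2 ?_
  intro Φ
  obtain ⟨x, rfl⟩ := h Φ
  change Tendsto (fun n => f n x) atTop (𝓝 0)
  exact squeeze_zero_norm (fun n => abs_apply_le_abs_apply_abs (f n) x) (habs |x| (abs_nonneg x))

end Forward

/-! ### The unbounded Grothendieck property implies reflexivity -/

section Backward

variable {E : Type*} [NormedAddCommGroup E] [Lattice E] [HasSolidNorm E] [IsOrderedAddMonoid E]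
  [NormedSpace ℝ E] [IsOrderedModule ℝ E]

theorem UnboundedGrothendieckProperty.tendsto_apply (h : UnboundedGrothendieckProperty E)
    {f : ℕ → StrongDual ℝ E} {M : ℝ} (hM : ∀ n, ‖f n‖ ≤ M) (hf : UawStarTendsto f 0)
    (Φ : StrongDual ℝ (StrongDual ℝ E)) : Tendsto (fun n => Φ (f n)) atTop (𝓝 0) := by
  refine tendsto_toWeakSpace_zero_iff.1 (h f ?_ hf) Φ
  exact isBounded_iff_forall_norm_le.2 ⟨M, by rintro _ ⟨n, rfl⟩; exact hM n⟩

/-- The unit ball of `E'` is almost order bounded with respect to every positive `Φ ∈ E''`: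
otherwise there is an almost disjoint sequence on which `Φ` stays away from zero. -/
theorem UnboundedGrothendieckProperty.exists_apply_posPart_sub_lt
    (h : UnboundedGrothendieckProperty E) (Φ : StrongDual ℝ (StrongDual ℝ E)) {ε : ℝ}
    (hε : 0 < ε) :
    ∃ F : StrongDual ℝ E, 0 ≤ F ∧
      ∀ f : StrongDual ℝ E, 0 ≤ f → ‖f‖ ≤ 1 → Φ (f - F)⁺ < ε := by
  by_contra! H
  obtain ⟨f, hf0, hf⟩ := exists_seq_rel_sum
    (R := fun F f : StrongDual ℝ E => ‖f‖ ≤ 1 ∧ ε ≤ Φ (f - F)⁺) H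
  refine absurd (ge_of_tendsto' (h.tendsto_apply (M := 1) (fun n => ?_)
    (uawStarTendsto_posPart_sub_sum hf0 fun n => (hf n).1) Φ) fun n => (hf n).2) (not_le.2 hε)
  exact (norm_le_norm_of_nonneg_of_le (posPart_nonneg _) (posPart_sub_le_self (hf0 n)
    (smul_nonneg (by positivity) (Finset.sum_nonneg fun j _ => hf0 j)))).trans (hf n).1

variable [CompleteSpace E]

/-- Increasing sequences in `E` that are order bounded in `E''` converge in norm: the almost order
boundedness of the unit ball of `E'` reduces the norm of an increment to its value at one
functional. -/
theorem UnboundedGrothendieckProperty.exists_tendsto_of_monotone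
    (h : UnboundedGrothendieckProperty E) {Φ : StrongDual ℝ (StrongDual ℝ E)} {y : ℕ → E}
    (hy : Monotone y) (h0 : ∀ n, 0 ≤ y n)
    (hΦ : ∀ n, NormedSpace.inclusionInDoubleDual ℝ E (y n) ≤ Φ) :
    ∃ a, Tendsto y atTop (𝓝 a) := by
  refine cauchySeq_tendsto_of_complete (Metric.cauchySeq_iff'.2 fun ε hε => ?_)
  obtain ⟨F, hF0, hF⟩ := h.exists_apply_posPart_sub_lt Φ (half_pos hε)
  obtain ⟨l, hl⟩ := exists_tendsto_of_monotone_of_le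
    (fun m n hmn => dual_apply_mono hF0 (hy hmn)) (fun n => hΦ n F hF0)
  obtain ⟨N, hN⟩ := Metric.cauchySeq_iff'.1 hl.cauchySeq (ε / 2) (half_pos hε)
  refine ⟨N, fun n hn => ?_⟩
  have hw : 0 ≤ y n - y N := sub_nonneg.2 (hy hn)
  obtain ⟨f, hf0, hf1, hf⟩ := exists_nonneg_functional hw
  have h1 : F (y n - y N) < ε / 2 := by
    rw [map_sub]
    exact (le_abs_self _).trans_lt (hN n hn)
  have h2 : (f - F)⁺ (y n - y N) < ε / 2 :=
    calc (f - F)⁺ (y n - y N) ≤ (f - F)⁺ (y n) :=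
          dual_apply_mono (posPart_nonneg _) (sub_le_self _ (h0 N))
      _ ≤ Φ (f - F)⁺ := hΦ n _ (posPart_nonneg _)
      _ < ε / 2 := hF f hf0 hf1
  have h3 := le_posPart (f - F) _ hw
  rw [sub_apply] at h3
  rw [dist_eq_norm]
  linarith

theorem UnboundedGrothendieckProperty.orderContinuousNorm (h : UnboundedGrothendieckProperty E) :
    OrderContinuousNorm E := fun _ _ hy h0 hx =>
  h.exists_tendsto_of_monotone hy h0 fun n => inclusionInDoubleDual_mono (hx n)

/-- The distance of an increasing sequence in `E'` to its pointwise limit decreases to zero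
pointwise, so it is uaw*-null, hence weakly null, hence norm null. -/
theorem UnboundedGrothendieckProperty.orderContinuousNorm_dual
    (h : UnboundedGrothendieckProperty E) : OrderContinuousNorm (StrongDual ℝ E) := by
  intro f u hf h0 hu
  obtain ⟨g, hg, hfg⟩ := exists_pointwise_limit_of_monotone hf fun x hx n => hu n x hx
  have hanti : Antitone fun n => g - f n := fun m n hmn => sub_le_sub_left (hf hmn) g
  have hpos : ∀ n, 0 ≤ g - f n := fun n => sub_nonneg.2 (hfg n)
  have huaw : UawStarTendsto (fun n => g - f n) 0 := by
    refine uawStarTendsto_zero_of_nonneg hpos fun v hv x hx => ?_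
    refine squeeze_zero (fun n => (le_inf (hpos n) hv : 0 ≤ (g - f n) ⊓ v) x hx)
      (fun n => inf_apply_le_left _ _ hx) ?_
    simpa using (hg x).const_sub (g x)
  have := tendsto_zero_of_antitone_of_weakly_null hanti hpos
    (h.tendsto_apply (M := ‖g - f 0‖) (fun n =>
      norm_le_norm_of_nonneg_of_le (hpos n) (hanti (Nat.zero_le n))) huaw)
  exact ⟨g, by simpa using this.const_sub g⟩

/-- If `E'` has order continuous norm, a positive element of `E''` that is disjoint from `E`
vanishes. -/
theorem apply_eq_zero_of_forall_inf_inclusion (hE' : OrderContinuousNorm (StrongDual ℝ E))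
    {θ : StrongDual ℝ (StrongDual ℝ E)} (hθ : 0 ≤ θ) {f : StrongDual ℝ E} (hf : 0 ≤ f)
    (H : ∀ x : E, 0 ≤ x → (θ ⊓ NormedSpace.inclusionInDoubleDual ℝ E x) f ≤ 0) : θ f = 0 := by
  obtain ⟨k, ⟨hk0, hkf, hθk⟩, hmax⟩ := exists_maximal_of_monotone_convergence
    (Y := {k : StrongDual ℝ E | 0 ≤ k ∧ k ≤ f ∧ θ k = 0})
    (isClosed_nonneg.inter ((isClosed_le continuous_id continuous_const).inter
      (isClosed_eq θ.continuous continuous_const)))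
    ⟨0, le_rfl, hf, map_zero θ⟩
    (fun y hy hyY => hE' y f hy (fun n => (hyY n).1) fun n => (hyY n).2.1)
  have hfk : f - k = 0 := by
    refine eq_zero_of_forall_nonneg_apply fun x hx => le_antisymm ?_ (sub_nonneg.2 hkf x hx)
    obtain ⟨a, ha0, haf, hθa, hax⟩ := hE'.exists_split hθ
      (inclusionInDoubleDual_mono hx |>.trans' (map_zero _).ge) hf (H x hx)
    have hsup : k ⊔ a = k := hmax _ ⟨hk0.trans le_sup_left, sup_le hkf haf, le_antisymm
      ((dual_apply_mono hθ (sup_le (le_add_of_nonneg_right ha0) (le_add_of_nonneg_left hk0))).trans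
        (by rw [map_add, hθk, hθa, add_zero])) (hθ _ (hk0.trans le_sup_left))⟩ le_sup_left
    exact (sub_le_sub_left (sup_eq_left.1 hsup) f x hx).trans hax.le
  rw [sub_eq_zero.1 hfk, hθk]

/-- Between `0` and a nonzero `θ ≤ x` in `E''` there is a nonzero positive element of `E`: some
multiple of the part `y` of `x` on which a functional `b`, chosen so that `c • x ≤ θ` on `[0, b]`,
lives. -/
theorem exists_inclusion_le_of_le_inclusion (hE : OrderContinuousNorm E)
    (hE' : OrderContinuousNorm (StrongDual ℝ E)) {θ : StrongDual ℝ (StrongDual ℝ E)} (hθ : 0 ≤ θ)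
    {x : E} (hx : 0 ≤ x) (hθx : θ ≤ NormedSpace.inclusionInDoubleDual ℝ E x) {f : StrongDual ℝ E}
    (hf : 0 ≤ f) (hθf : 0 < θ f) :
    ∃ y : E, 0 ≤ y ∧ y ≠ 0 ∧ NormedSpace.inclusionInDoubleDual ℝ E y ≤ θ := by
  set J := NormedSpace.inclusionInDoubleDual ℝ E with hJ
  have hfx : 0 < f x := hθf.trans_le (hθx f hf)
  set c : ℝ := θ f / (2 * f x) with hc
  have hc0 : 0 < c := by positivity
  have hcf : c * f x < θ f := by
    have : c * f x = θ f / 2 := by rw [hc]; field_simp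
    linarith
  obtain ⟨a, ha0, haf, hαa, hβb⟩ := hE'.exists_split (posPart_nonneg (θ - c • J x))
    (negPart_nonneg (θ - c • J x)) hf (by rw [posPart_inf_negPart_eq_zero]; exact le_rfl)
  set b := f - a with hb
  have hb0 : 0 ≤ b := sub_nonneg.2 haf
  have hbx : 0 < b x := by
    have h1 := le_posPart (θ - c • J x) a ha0
    rw [hαa] at h1
    have h2 := hθx b hb0
    have h3 : θ f = θ a + θ b := by rw [← map_add, hb, add_sub_cancel]
    have h4 := mul_le_mul_of_nonneg_left (haf x hx) hc0.le
    simp only [sub_apply, smul_apply, smul_eq_mul, hJ, NormedSpace.dual_def] at h1 h2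
    linarith
  -- by maximality of `w`, `x - w` is the part of `x` on which `b` lives
  obtain ⟨w, ⟨hw0, hwx, hbw⟩, hmax⟩ := exists_maximal_of_monotone_convergence
    (Y := {w : E | 0 ≤ w ∧ w ≤ x ∧ b w = 0})
    (isClosed_nonneg.inter ((isClosed_le continuous_id continuous_const).inter
      (isClosed_eq b.continuous continuous_const)))
    ⟨0, le_rfl, hx, map_zero b⟩
    (fun y hy hyY => hE y x hy (fun n => (hyY n).1) fun n => (hyY n).2.1)
  set y := x - w with hy
  have hy0 : 0 ≤ y := sub_nonneg.2 hwx
  have hJy0 : 0 ≤ c • J y :=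
    smul_nonneg hc0.le ((map_zero J).symm.le.trans (inclusionInDoubleDual_mono hy0))
  have hρ : (c • J y - θ)⁺ = 0 := by
    by_contra hne
    set ρ := (c • J y - θ)⁺ with hρdef
    have hρ0 : 0 ≤ ρ := posPart_nonneg _
    obtain ⟨f', hf'0, hρf'⟩ := exists_apply_pos hρ0 hne
    have hρb : ρ b ≤ 0 := by
      have hle : ρ ≤ (θ - c • J x)⁻ := by
        rw [hρdef, negPart_def, posPart_def]
        refine sup_le_sup_right (le_of_le_of_eq (sub_le_sub_right (smul_le_smul_of_nonneg_left
          (inclusionInDoubleDual_mono (sub_le_self x hw0)) hc0.le) θ) (neg_sub _ _).symm) 0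
      exact (hle b hb0).trans hβb.le
    have hρy : ρ ≤ c • J y := sup_le (sub_le_self _ hθ) hJy0
    have hanti : Antitone fun n : ℕ => (f' - (n : ℝ) • b)⁺ := fun m n hmn =>
      posPart_mono (sub_le_sub_left (smul_le_smul_of_nonneg_right (Nat.cast_le.2 hmn) hb0) f')
    -- the limit `g` is the part of `f'` disjoint from `b`
    obtain ⟨g, hg⟩ := hE'.exists_tendsto_of_antitone hanti fun n => posPart_nonneg _
    have hg0 : 0 ≤ g := ge_of_tendsto' hg fun n => posPart_nonneg _
    have hρg : ρ f' ≤ ρ g := by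
      refine ge_of_tendsto' ((ρ.continuous.tendsto g).comp hg) fun n => ?_
      have h1 := dual_apply_mono hρ0 (le_posPart (f' - (n : ℝ) • b))
      have h2 := mul_nonpos_of_nonneg_of_nonpos (Nat.cast_nonneg (α := ℝ) n) hρb
      rw [map_sub, map_smul, smul_eq_mul] at h1
      exact (by linarith : ρ f' ≤ ρ f' - n * ρ b).trans h1
    have hbg : (b ⊓ g) y ≤ 0 := by
      refine ge_of_tendsto' (zero_mul (f' y) ▸
        (tendsto_one_div_add_atTop_nhds_zero_nat (𝕜 := ℝ)).mul_const (f' y)) fun n => ?_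
      have h1 : b ⊓ g ≤ (1 + (n : ℝ))⁻¹ • f' :=
        (le_inf (inf_le_right.trans (hanti.le_of_tendsto hg n)) inf_le_left).trans
          (posPart_sub_smul_inf_le hf'0 (Nat.cast_nonneg n))
      have h2 := h1 y hy0
      rwa [smul_apply, smul_eq_mul, add_comm, ← one_div] at h2
    obtain ⟨v, hv0, hvy, hbv, hgv⟩ := hE.exists_split hb0 hg0 hy0 hbg
    have hwv := hmax (w + v) ⟨add_nonneg hw0 hv0, le_sub_iff_add_le'.1 hvy, by
      rw [map_add, hbw, hbv, add_zero]⟩ (le_add_of_nonneg_right hv0)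
    rw [add_eq_left.1 hwv, sub_zero] at hgv
    have h1 := hρy g hg0
    simp only [smul_apply, smul_eq_mul, hJ, NormedSpace.dual_def, hgv, mul_zero] at h1
    linarith
  refine ⟨c • y, smul_nonneg hc0.le hy0, fun h0 => ?_, ?_⟩
  · have hy' : y = 0 := (smul_eq_zero.1 h0).resolve_left hc0.ne'
    have : b y = b x := by rw [hy, map_sub, hbw, sub_zero]
    rw [hy', map_zero] at this
    exact hbx.ne this
  · rw [map_smul]
    exact sub_nonpos.1 (posPart_eq_zero.1 hρ)

/-- A maximal `y ∈ E` below `Φ` equals `Φ`: otherwise the remainder `Φ - y` is not disjoint from `E`,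
so it dominates a nonzero positive element of `E`, which can be added to `y`. -/
theorem UnboundedGrothendieckProperty.mem_range_of_nonneg (h : UnboundedGrothendieckProperty E)
    {Φ : StrongDual ℝ (StrongDual ℝ E)} (hΦ : 0 ≤ Φ) :
    ∃ y : E, NormedSpace.inclusionInDoubleDual ℝ E y = Φ := by
  set J := NormedSpace.inclusionInDoubleDual ℝ E with hJ
  have hclosed : IsClosed {y : E | J y ≤ Φ} := by
    simp only [dual_le_def, Set.ofPred_forall]
    exact isClosed_iInter fun f => isClosed_iInter fun _ =>
      isClosed_le f.continuous continuous_const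
  obtain ⟨y, ⟨hy0, hyΦ⟩, hmax⟩ := exists_maximal_of_monotone_convergence
    (Y := {y : E | 0 ≤ y ∧ J y ≤ Φ})
    (isClosed_nonneg.inter hclosed)
    ⟨0, le_rfl, (map_zero J).le.trans hΦ⟩
    (fun y hy hyY => h.exists_tendsto_of_monotone hy (fun n => (hyY n).1) fun n => (hyY n).2)
  refine ⟨y, ?_⟩
  by_contra hne
  have hθ0 : 0 ≤ Φ - J y := sub_nonneg.2 hyΦ
  obtain ⟨f, hf0, hf⟩ := exists_apply_pos hθ0 (sub_ne_zero.2 (Ne.symm hne))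
  obtain ⟨x, hx0, hx⟩ : ∃ x : E, 0 ≤ x ∧ 0 < ((Φ - J y) ⊓ J x) f := by
    by_contra! H
    exact hf.ne' (apply_eq_zero_of_forall_inf_inclusion h.orderContinuousNorm_dual hθ0 hf0 H)
  obtain ⟨v, hv0, hvne, hv⟩ := exists_inclusion_le_of_le_inclusion h.orderContinuousNorm
    h.orderContinuousNorm_dual
    (le_inf hθ0 ((map_zero J).symm.le.trans (inclusionInDoubleDual_mono hx0)))
    hx0 inf_le_right hf0 hx
  refine hvne (add_eq_left.1 (hmax (y + v) ⟨add_nonneg hy0 hv0, ?_⟩ (le_add_of_nonneg_right hv0)))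
  rw [map_add]
  exact le_sub_iff_add_le'.1 (hv.trans inf_le_left)

theorem UnboundedGrothendieckProperty.isReflexiveSpace (h : UnboundedGrothendieckProperty E) :
    IsReflexiveSpace E := by
  intro Φ
  obtain ⟨u, hu⟩ := h.mem_range_of_nonneg (posPart_nonneg Φ)
  obtain ⟨v, hv⟩ := h.mem_range_of_nonneg (negPart_nonneg Φ)
  exact ⟨u - v, by rw [map_sub, hu, hv, posPart_sub_negPart]⟩

end Backward

end BanachLattice

end

theorem mainTheorem1 (E : Type*) [NormedAddCommGroup E] [NormedSpace ℝ E] [CompleteSpace E]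
    [Lattice E] [IsOrderedAddMonoid E] [IsOrderedModule ℝ E] [HasSolidNorm E] :
    BanachLattice.IsReflexiveSpace E ↔ BanachLattice.UnboundedGrothendieckProperty E :=
  ⟨fun h => h.unboundedGrothendieckProperty, fun h => h.isReflexiveSpace⟩
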